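/- Theorem. Let $V$ be a finite-dimensional vector space over $\mathbb{R}$ or $\mathbb{C}$ with a non-degenerate symmetric bilinear form $(\,,)$, and let $[\,,]$ be the Poisson superalgebra bracket on $\bigwedge V$, i.e. the bilinear bracket with $[x,y]=(x,y)$ for $x,y\in V$, $[v,w_1 w_2]=[v,w_1]w_2+(-1)^{|v||w_1|}w_1[v,w_2]$ and $[v,w]=-(-1)^{|v||w|}[w,v]$ for homogeneous $v,w,w_1,w_2\in\bigwedge V$. For $x_1,\dots,x_p\in V$ and $w\in\bigwedge V$ write $[x_{I^p},w]:=[x_1,[x_2,\ldots[x_p,w]\ldots]]$, where $[x_{I^0},w]=w$. Let $0\le l\le r<n$ be integers and let $\mu\colon V^n\to V$ be a skew-symmetric $n$-linear map that is invariant, i.e. $(b,\mu(a_1,\dots,a_n))=-(a_1,\mu(b,a_2,\dots,a_n))$ for all $b,a_i\in V$. Then there is $\tilde\mu\in\bigwedge^{n+1}V$ such that $$\mu(a_1,\dots,a_n)=[a_1,[\ldots,[a_n,\tilde\mu]\ldots]]\quad\text{for all } a_i\in V,\qquad (*)$$ and for every $\tilde\mu\in\bigwedge^{n+1}V$ satisfying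 $(*)$, the pair $(V,\mu)$ is an $n$-ary Lie algebra of type $(r,l)$ if and only if $$[[a_{I^r},\tilde\mu],[b_{I^l},\tilde\mu]]=0\quad\text{for all } a_1,\dots,a_r,b_1,\dots,b_l\in V.$$ Here $(V,\mu)$ is an $n$-ary Lie algebra of type $(r,l)$ if $[\mu_{a_1,\dots,a_r},\mu_{b_1,\dots,b_l}]^{NR}=0$ for all $a_i,b_j\in V$, where $\mu_{a_1,\dots,a_p}(c_1,\dots,c_{n-p})=\mu(a_1,\dots,a_p,c_1,\dots,c_{n-p})$ and where, for an alternating $s$-linear map $L$ and an alternating $k$-linear map $K$ on $V$ with values in $V$ ($s,k\ge1$), the Nijenhuis–Richardson bracket is $$[L,K]^{NR}=(-1)^{(s-1)(k-1)}L[K]-K[L],\qquad L[K](x_1,\dots,x_{s+k-1})=\sum_{(I,J)}(-1)^{(I,J)}L(K(x_I),x_J),$$ the sum being over all pairs of ordered multi-indices $I$, $J$ with $|I|=k$, $|J|=s-1$ that together form $\{1,\dots,s+k-1\}$, and $(-1)^{(I,J)}$ being the sign of the permutation $(I,J)$ of $(1,\dots,s+k-1)$. -/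

import Mathlib

/-! ### The Poisson superalgebra structure on the exterior algebra -/

section Poisson

variable {K : Type*} [Field K] {V : Type*} [AddCommGroup V] [Module K V]

/-- The Poisson bracket on `⋀ V` attached to a bilinear form `B` on a finite-dimensional space `V`:
`[v, w] = ∑ i, (v ⌊ B(e i, ·)) * (eⁱ ⌋ w)`, where `e` is a basis of `V`, `eⁱ` is the dual basis of
the dual space, and `⌊`, `⌋` are the right and left contractions (odd derivations).
The theorems `poissonBracket_ι_ι`, `poissonBracket_mul_right` and `poissonBracket_skew`
below are the three formulas that characterise this bracket. -/
noncomputable def poissonBracket [FiniteDimensional K V] (B : LinearMap.BilinForm K V) :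
    ExteriorAlgebra K V →ₗ[K] ExteriorAlgebra K V →ₗ[K] ExteriorAlgebra K V :=
  ∑ i, (LinearMap.mul K (ExteriorAlgebra K V)).compl₁₂
    (CliffordAlgebra.contractRight.flip (B (Module.finBasis K V i)))
    (CliffordAlgebra.contractLeft ((Module.finBasis K V).coord i))

theorem poissonBracket_apply [FiniteDimensional K V] (B : LinearMap.BilinForm K V)
    (v w : ExteriorAlgebra K V) :
    poissonBracket B v w = ∑ i, CliffordAlgebra.contractRight v (B (Module.finBasis K V i)) *
      CliffordAlgebra.contractLeft ((Module.finBasis K V).coord i) w := by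
  simp [poissonBracket, LinearMap.sum_apply]

/-- `[x, ·]` for a vector `x` is the left contraction with `(x, ·)`. -/
theorem poissonBracket_ι_left [FiniteDimensional K V] (B : LinearMap.BilinForm K V)
    (hB : B.IsSymm) (x : V) (w : ExteriorAlgebra K V) :
    poissonBracket B (ExteriorAlgebra.ι K x) w = CliffordAlgebra.contractLeft (B x) w := by
  rw [poissonBracket_apply]
  have h : B x = ∑ i, B (Module.finBasis K V i) x • (Module.finBasis K V).coord i := by
    refine (Module.finBasis K V).ext fun j => ?_
    simp [Finsupp.single_apply, hB.eq x]
  conv_rhs => rw [h]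
  rw [map_sum, LinearMap.sum_apply]
  refine Finset.sum_congr rfl fun i _ => ?_
  rw [ExteriorAlgebra.ι, CliffordAlgebra.contractRight_ι, map_smul, LinearMap.smul_apply,
    Algebra.smul_def]

/-- `[x, y] = (x, y)` for vectors `x`, `y`. -/
theorem poissonBracket_ι_ι [FiniteDimensional K V] (B : LinearMap.BilinForm K V)
    (hB : B.IsSymm) (x y : V) :
    poissonBracket B (ExteriorAlgebra.ι K x) (ExteriorAlgebra.ι K y) =
      algebraMap K (ExteriorAlgebra K V) (B x y) := by
  rw [poissonBracket_ι_left B hB, ExteriorAlgebra.ι, CliffordAlgebra.contractLeft_ι]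

theorem exterior_ι_mul_comm {q : ℕ} (x : V) {w : ExteriorAlgebra K V} (hw : w ∈ ⋀[K]^q V) :
    ExteriorAlgebra.ι K x * w = ((-1 : K) ^ q) • (w * ExteriorAlgebra.ι K x) := by
  induction hw using Submodule.pow_induction_on_left' with
  | algebraMap r => simp [Algebra.commutes]
  | add a b i ha hb iha ihb => rw [mul_add, iha, ihb, add_mul, smul_add]
  | mem_mul m hm i a ha ih =>
    obtain ⟨y, rfl⟩ := hm
    have h := eq_neg_of_add_eq_zero_left (ExteriorAlgebra.ι_add_mul_swap (R := K) x y)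
    rw [← mul_assoc, h, neg_mul, mul_assoc, ih, mul_smul_comm, pow_succ, mul_assoc]
    simp

theorem exterior_mul_comm {p q : ℕ} {v w : ExteriorAlgebra K V} (hv : v ∈ ⋀[K]^p V)
    (hw : w ∈ ⋀[K]^q V) : v * w = ((-1 : K) ^ (p * q)) • (w * v) := by
  induction hv using Submodule.pow_induction_on_left' with
  | algebraMap r => simp [Algebra.commutes]
  | add a b i ha hb iha ihb => rw [add_mul, iha, ihb, mul_add, smul_add]
  | mem_mul m hm i a ha ih =>
    obtain ⟨y, rfl⟩ := hm
    rw [mul_assoc, ih, mul_smul_comm, ← mul_assoc, exterior_ι_mul_comm y hw, smul_mul_assoc,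
      smul_smul, ← pow_add, mul_assoc]
    congr 2; rw [Nat.succ_eq_add_one]; ring

theorem contractLeft_mul_of_mem {p : ℕ} (d : Module.Dual K V) {v : ExteriorAlgebra K V}
    (hv : v ∈ ⋀[K]^p V) (w : ExteriorAlgebra K V) :
    CliffordAlgebra.contractLeft d (v * w) = CliffordAlgebra.contractLeft d v * w +
      ((-1 : K) ^ p) • (v * CliffordAlgebra.contractLeft d w) := by
  induction hv using Submodule.pow_induction_on_left' with
  | algebraMap r => simp [CliffordAlgebra.contractLeft_algebraMap_mul]
  | add a b i ha hb iha ihb =>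
    rw [add_mul, map_add, iha, ihb, map_add, add_mul, add_mul, smul_add]; abel
  | mem_mul m hm i a ha ih =>
    obtain ⟨y, rfl⟩ := hm
    rw [ExteriorAlgebra.ι, mul_assoc, CliffordAlgebra.contractLeft_ι_mul, ih,
      CliffordAlgebra.contractLeft_ι_mul, pow_succ]
    simp only [mul_add, sub_mul, smul_mul_assoc, mul_assoc, mul_smul_comm, mul_neg, mul_one,
      neg_smul]
    abel

theorem contractLeft_mem {p : ℕ} (d : Module.Dual K V) {v : ExteriorAlgebra K V}
    (hv : v ∈ ⋀[K]^p V) : CliffordAlgebra.contractLeft d v ∈ ⋀[K]^(p - 1) V := by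
  induction hv using Submodule.pow_induction_on_left' with
  | algebraMap r => rw [CliffordAlgebra.contractLeft_algebraMap]; exact zero_mem _
  | add a b i ha hb iha ihb => rw [map_add]; exact add_mem iha ihb
  | mem_mul m hm i a ha ih =>
    obtain ⟨y, rfl⟩ := hm
    rw [ExteriorAlgebra.ι, CliffordAlgebra.contractLeft_ι_mul]
    refine sub_mem (Submodule.smul_mem _ _ ha) ?_
    rcases i with _ | i
    · obtain ⟨r, rfl⟩ := Submodule.mem_one.1 (by simpa using ha)
      simp
    · have := Submodule.mul_mem_mul (LinearMap.mem_range_self (ExteriorAlgebra.ι K) y) ih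
      rw [← pow_succ'] at this
      exact this

theorem contractRight_of_mem {p : ℕ} (d : Module.Dual K V) {v : ExteriorAlgebra K V}
    (hv : v ∈ ⋀[K]^p V) : CliffordAlgebra.contractRight v d =
      ((-1 : K) ^ (p + 1)) • CliffordAlgebra.contractLeft d v := by
  induction hv using Submodule.pow_induction_on_left' with
  | algebraMap r =>
    rw [CliffordAlgebra.contractLeft_algebraMap, CliffordAlgebra.contractRight_algebraMap,
      smul_zero]
  | add a b i ha hb iha ihb => rw [map_add, LinearMap.add_apply, iha, ihb, map_add, smul_add]
  | mem_mul m hm i a ha ih =>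
    obtain ⟨y, rfl⟩ := hm
    have h1 := exterior_ι_mul_comm y ha
    rw [h1, map_smul, LinearMap.smul_apply, map_smul, contractLeft_mul_of_mem d ha]
    rw [ExteriorAlgebra.ι, CliffordAlgebra.contractRight_mul_ι, ih,
      CliffordAlgebra.contractLeft_ι]
    rcases Nat.even_or_odd i with hi | hi
    · simp [pow_succ, hi.neg_one_pow, Algebra.smul_def, Algebra.commutes]; abel
    · simp [pow_succ, hi.neg_one_pow, Algebra.smul_def, Algebra.commutes]; abel

/-- The Leibniz rule `[v, w₁ w₂] = [v, w₁] w₂ + (-1)^(|v| |w₁|) w₁ [v, w₂]`. -/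
theorem poissonBracket_mul_right [FiniteDimensional K V] (B : LinearMap.BilinForm K V) {p q : ℕ}
    {v w₁ : ExteriorAlgebra K V} (hv : v ∈ ⋀[K]^p V) (hw₁ : w₁ ∈ ⋀[K]^q V)
    (w₂ : ExteriorAlgebra K V) :
    poissonBracket B v (w₁ * w₂) = poissonBracket B v w₁ * w₂ +
      ((-1 : K) ^ (p * q)) • (w₁ * poissonBracket B v w₂) := by
  simp only [poissonBracket_apply, Finset.sum_mul, Finset.mul_sum, Finset.smul_sum]
  rw [← Finset.sum_add_distrib]
  refine Finset.sum_congr rfl fun i _ => ?_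
  rw [contractLeft_mul_of_mem _ hw₁, mul_add, mul_assoc, add_right_inj, mul_smul_comm,
    contractRight_of_mem _ hv, ← mul_assoc, ← mul_assoc]
  rcases p with _ | p
  · obtain ⟨r, rfl⟩ := Submodule.mem_one.1 (by simpa using hv)
    simp
  · have h := contractLeft_mem (B (Module.finBasis K V i)) hv
    rw [smul_mul_assoc, mul_smul_comm, exterior_mul_comm h hw₁]
    simp only [Nat.add_sub_cancel, smul_mul_assoc, smul_smul]
    congr 1
    rw [add_mul, one_mul, pow_add (-1 : K) (p * q) q]
    ring

/-- Super skew-symmetry `[v, w] = -(-1)^(|v| |w|) [w, v]`. -/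
theorem poissonBracket_skew [FiniteDimensional K V] (B : LinearMap.BilinForm K V)
    (hB : B.IsSymm) {p q : ℕ} {v w : ExteriorAlgebra K V}
    (hv : v ∈ ⋀[K]^p V) (hw : w ∈ ⋀[K]^q V) :
    poissonBracket B v w = -(((-1 : K) ^ (p * q)) • poissonBracket B w v) := by
  have key : ∀ (a : ℕ) (x y : ExteriorAlgebra K V), x ∈ ⋀[K]^a V → poissonBracket B x y =
      ((-1 : K) ^ (a + 1)) • ∑ i, ∑ j, B (Module.finBasis K V i) (Module.finBasis K V j) •
        (CliffordAlgebra.contractLeft ((Module.finBasis K V).coord j) x *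
          CliffordAlgebra.contractLeft ((Module.finBasis K V).coord i) y) := by
    intro a x y hx
    rw [poissonBracket_apply, Finset.smul_sum]
    refine Finset.sum_congr rfl fun i _ => ?_
    have h : B (Module.finBasis K V i) =
        ∑ j, B (Module.finBasis K V i) (Module.finBasis K V j) • (Module.finBasis K V).coord j := by
      refine (Module.finBasis K V).ext fun j => ?_
      simp
    rw [contractRight_of_mem _ hx, smul_mul_assoc]
    conv_lhs => rw [h]
    simp only [map_sum, LinearMap.sum_apply, map_smul, LinearMap.smul_apply, Finset.sum_mul,
      smul_mul_assoc]
  rw [key p v w hv, key q w v hw, Finset.sum_comm]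
  simp only [Finset.smul_sum, ← Finset.sum_neg_distrib]
  refine Finset.sum_congr rfl fun i _ => Finset.sum_congr rfl fun j _ => ?_
  rw [hB.eq (Module.finBasis K V j)]
  rcases p with _ | p
  · obtain ⟨r, rfl⟩ := Submodule.mem_one.1 (by simpa using hv)
    simp
  rcases q with _ | q
  · obtain ⟨r, rfl⟩ := Submodule.mem_one.1 (by simpa using hw)
    simp
  rw [exterior_mul_comm (contractLeft_mem _ hv) (contractLeft_mem _ hw)]
  simp only [Nat.add_sub_cancel, smul_smul, ← neg_smul]
  congr 1
  rcases Nat.even_or_odd p with hp | hp <;> rcases Nat.even_or_odd q with hq | hq <;>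
    simp [pow_succ, pow_mul, hp.neg_one_pow, hq.neg_one_pow]

/-- The iterated bracket `[a₁, [a₂, … [a_p, w] … ]]` of vectors `a₁, …, a_p` with `w ∈ ⋀ V`. -/
noncomputable def iterPoissonBracket [FiniteDimensional K V] (B : LinearMap.BilinForm K V) {p : ℕ}
    (a : Fin p → V) (w : ExteriorAlgebra K V) : ExteriorAlgebra K V :=
  (List.ofFn a).foldr (fun x u => poissonBracket B (ExteriorAlgebra.ι K x) u) w

/-- `μ` is the `n`-ary structure `{a₁, …, a_n} = [a₁, [ … [a_n, m] … ]]` derived from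
`m ∈ ⋀ⁿ⁺¹ V`; the vector on the left is viewed in `⋀ V`. -/
def IsDerivedFrom [FiniteDimensional K V] (B : LinearMap.BilinForm K V) {n : ℕ}
    (μ : V [⋀^Fin n]→ₗ[K] V) (m : ⋀[K]^(n + 1) V) : Prop :=
  ∀ a : Fin n → V, ExteriorAlgebra.ι K (μ a) = iterPoissonBracket B a (m : ExteriorAlgebra K V)

end Poisson

/-! ### The Nijenhuis-Richardson bracket and `n`-ary Lie algebras of type `(r, l)` -/

section NijenhuisRichardson

variable {K : Type*} [Field K] {V : Type*} [AddCommGroup V] [Module K V]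

/-- The permutations `σ` of `{0, …, N - 1}` with `σ 0 < ⋯ < σ (k - 1)` and
`σ k < ⋯ < σ (N - 1)`, that is, the pairs `(I, J)` of ordered multi-indices with `|I| = k` and
`I + J = (0, …, N - 1)`. -/
def unshuffles (k N : ℕ) : Finset (Equiv.Perm (Fin N)) :=
  Finset.univ.filter fun σ =>
    (∀ i j : Fin N, i < j → (j : ℕ) < k → σ i < σ j) ∧
      (∀ i j : Fin N, k ≤ (i : ℕ) → i < j → σ i < σ j)

/-- `M[P](a) = ∑ (-1)^(I, J) M(P(a_I), a_J)` for an `l`-linear map `M` and a `k`-linear map `P`,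
`l ≥ 1`, the sum being over `I + J = (1, …, l + k - 1)` with `|I| = k`, `|J| = l - 1`. -/
def insertion {l k : ℕ} (hl : 0 < l) (M : V [⋀^Fin l]→ₗ[K] V) (P : V [⋀^Fin k]→ₗ[K] V)
    (a : Fin (l + k - 1) → V) : V :=
  ∑ σ ∈ unshuffles k (l + k - 1), (Equiv.Perm.sign σ : ℤ) •
    M fun j => if hj : (j : ℕ) = 0 then P fun i => a (σ ⟨i, by omega⟩)
      else a (σ ⟨k + (j - 1), by omega⟩)

/-- The Nijenhuis-Richardson bracket
`[M, P]ᴺᴿ = (-1)^((l - 1)(k - 1)) M[P] - P[M]` for `l, k ≥ 1`, as a map of `l + k - 1` vectors. -/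
def nijenhuisRichardson {l k : ℕ} (hl : 0 < l) (hk : 0 < k) (M : V [⋀^Fin l]→ₗ[K] V)
    (P : V [⋀^Fin k]→ₗ[K] V) (a : Fin (l + k - 1) → V) : V :=
  (-1 : ℤ) ^ ((l - 1) * (k - 1)) • insertion hl M P a -
    insertion hk P M fun i => a (Fin.cast (by omega) i)

/-- The `(n - p)`-linear map `μ_{a₁, …, a_p}(b₁, …, b_{n-p}) = μ(a₁, …, a_p, b₁, …, b_{n-p})`. -/
def partialApply {n p : ℕ} (hp : p ≤ n) (μ : V [⋀^Fin n]→ₗ[K] V) (a : Fin p → V) :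
    V [⋀^Fin (n - p)]→ₗ[K] V where
  toFun b := μ fun i => Fin.append a b (Fin.cast (by omega) i)
  map_update_add' := by
    intro inst b i x y
    have h : ∀ z : V, (fun t : Fin n => Fin.append a (Function.update b i z)
        (Fin.cast (by omega : n = p + (n - p)) t)) =
        Function.update (fun t : Fin n => Fin.append a b (Fin.cast (by omega) t))
          (Fin.cast (by omega) (Fin.natAdd p i)) z := by
      intro z
      funext t
      obtain ⟨t, rfl⟩ : ∃ t' : Fin (p + (n - p)), t = Fin.cast (by omega) t' :=
        ⟨Fin.cast (by omega) t, rfl⟩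
      induction t using Fin.addCases with
      | left t => simp [Function.update_apply, Fin.ext_iff]; omega
      | right t => simp [Function.update_apply, Fin.ext_iff]
    simp only [h, AlternatingMap.map_update_add]
  map_update_smul' := by
    intro inst b i c x
    have h : ∀ z : V, (fun t : Fin n => Fin.append a (Function.update b i z)
        (Fin.cast (by omega : n = p + (n - p)) t)) =
        Function.update (fun t : Fin n => Fin.append a b (Fin.cast (by omega) t))
          (Fin.cast (by omega) (Fin.natAdd p i)) z := by
      intro z
      funext t
      obtain ⟨t, rfl⟩ : ∃ t' : Fin (p + (n - p)), t = Fin.cast (by omega) t' :=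
        ⟨Fin.cast (by omega) t, rfl⟩
      induction t using Fin.addCases with
      | left t => simp [Function.update_apply, Fin.ext_iff]; omega
      | right t => simp [Function.update_apply, Fin.ext_iff]
    simp only [h, AlternatingMap.map_update_smul]
  map_eq_zero_of_eq' := by
    intro b i j hb hij
    refine μ.map_eq_zero_of_eq _ (i := Fin.cast (by omega) (Fin.natAdd p i))
      (j := Fin.cast (by omega) (Fin.natAdd p j)) ?_ ?_
    · simpa using hb
    · simpa [Fin.ext_iff] using hij

/-- `(V, μ)` is an `n`-ary Lie algebra of type `(r, l)`, where `0 ≤ l ≤ r < n`: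
`[μ_{a₁, …, a_r}, μ_{b₁, …, b_l}]ᴺᴿ = 0` for all vectors `a_i`, `b_j`. -/
def IsNaryLieAlgebra {n : ℕ} (μ : V [⋀^Fin n]→ₗ[K] V) (r l : ℕ) (hlr : l ≤ r) (hrn : r < n) :
    Prop :=
  ∀ (a : Fin r → V) (b : Fin l → V),
    nijenhuisRichardson (Nat.sub_pos_of_lt hrn) (Nat.sub_pos_of_lt (hlr.trans_lt hrn))
      (partialApply hrn.le μ a) (partialApply (hlr.trans hrn.le) μ b) = 0

/-- `μ` is invariant with respect to `B`:
`(b, {a₁, …, a_n}) = -(a₁, {b, a₂, …, a_n})` for all vectors, `n ≥ 1`. -/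
def IsInvariantForm (B : LinearMap.BilinForm K V) {n : ℕ} (hn : 0 < n)
    (μ : V [⋀^Fin n]→ₗ[K] V) : Prop :=
  ∀ (b : V) (a : Fin n → V),
    B b (μ a) = -B (a ⟨0, hn⟩) (μ (Function.update a ⟨0, hn⟩ b))

end NijenhuisRichardson

/-!
Write `ι_x` for the contraction of `⋀ V` with `(x, ·)`; it is the bracket `[x, ·]` with the vector
`x`, so that iterated brackets with vectors are compositions of contractions (`iterContract`).

Existence of `m`: invariance makes `(a₀, …, a_n) ↦ (a₀, μ(a₁, …, a_n))` an alternating form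
(`IsInvariantForm.toAlternatingMap`). Contraction pairs `⋀ᵖ V` with itself. Since `(·,·)` is
non-degenerate and the characteristic is zero, Euler's identity `∑ eᵢ (eⁱ ⌋ u) = p u` makes this
pairing injective, hence perfect, so every alternating form is given by contracting an element of
`⋀ᵖ V` (`exists_iterContract_eq`).

Equivalence: up to sign, `μ_{a₁, …, a_r}` and `μ_{b₁, …, b_l}` are derived from
`v = [a₁, [ … [a_r, m] … ]]` and `w = [b₁, [ … [b_l, m] … ]]`, of degrees `s + 1` and `k + 1`, where
`s = n - r` and `k = n - l`. The bracket `[v, w]` has degree `s + k`, so it vanishes if and only if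
all its contractions with `s + k - 1` vectors do, and these contractions are, up to sign, the values
of the Nijenhuis-Richardson bracket (`iterContract_poissonBracket`). For the last point, `[v, w]` is
the image under multiplication of a tensor in `⋀ V ⊗ ⋀ V`, and contracting a product amounts to
applying `α_x + β_x` to the tensor, where the anticommuting operators `α_x` and `β_x` contract the
first and the second factor. The product of the operators `α_{xᵢ} + β_{xᵢ}` splits by the number of
`α`'s; sorting the words of such a part gives a signed sum over unshuffles (`mixedTerm_ofFn`). For
degree reasons two parts survive: one contracts the first factor to a scalar and gives
`μ_b[μ_a]`, the other contracts the second factor to a scalar and gives `μ_a[μ_b]`.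
-/

/-! ### Unshuffles -/

open Equiv in
/-- Insert `0` at position `p` of a permutation of `N` letters, raising the other values by one. -/
def insertZero {N : ℕ} (p : Fin (N + 1)) (τ : Perm (Fin N)) : Perm (Fin (N + 1)) :=
  Perm.decomposeFin.symm (0, τ) * p.cycleRange

theorem insertZero_self {N : ℕ} (p : Fin (N + 1)) (τ : Equiv.Perm (Fin N)) :
    insertZero p τ p = 0 := by
  simp [insertZero]

theorem insertZero_succAbove {N : ℕ} (p : Fin (N + 1)) (τ : Equiv.Perm (Fin N)) (j : Fin N) :
    insertZero p τ (p.succAbove j) = (τ j).succ := by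
  simp [insertZero, Fin.cycleRange_succAbove]

theorem sign_insertZero {N : ℕ} (p : Fin (N + 1)) (τ : Equiv.Perm (Fin N)) :
    Equiv.Perm.sign (insertZero p τ) = (-1) ^ (p : ℕ) * Equiv.Perm.sign τ := by
  simp [insertZero, mul_comm]

theorem insertZero_bijective (N : ℕ) :
    Function.Bijective fun x : Fin (N + 1) × Equiv.Perm (Fin N) => insertZero x.1 x.2 := by
  refine (Fintype.bijective_iff_injective_and_card _).2 ⟨?_, ?_⟩
  · rintro ⟨p, τ⟩ ⟨q, ρ⟩ h
    have hpq : p = q := by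
      have h1 := insertZero_self p τ
      rw [show insertZero p τ = insertZero q ρ from h, ← insertZero_self q ρ] at h1
      exact (insertZero q ρ).injective h1
    subst hpq
    have h2 := Equiv.Perm.decomposeFin.symm.injective (mul_right_cancel h)
    simpa using h2
  · simp [Fintype.card_perm, Nat.factorial_succ]

theorem mem_unshuffles {k N : ℕ} {σ : Equiv.Perm (Fin N)} :
    σ ∈ unshuffles k N ↔ (∀ i j : Fin N, i < j → (j : ℕ) < k → σ i < σ j) ∧
      (∀ i j : Fin N, k ≤ (i : ℕ) → i < j → σ i < σ j) := by
  simp [unshuffles]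

theorem insertZero_zero_mem {k N : ℕ} {τ : Equiv.Perm (Fin N)} :
    insertZero 0 τ ∈ unshuffles (k + 1) (N + 1) ↔ τ ∈ unshuffles k N := by
  have h0 := insertZero_self 0 τ
  have hs : ∀ j : Fin N, insertZero 0 τ j.succ = (τ j).succ := fun j => by
    simpa using insertZero_succAbove 0 τ j
  simp [mem_unshuffles, Fin.forall_fin_succ, h0, hs]

theorem insertZero_mem {k N : ℕ} (hk : k ≤ N) {τ : Equiv.Perm (Fin N)} :
    insertZero ⟨k, Nat.lt_succ_of_le hk⟩ τ ∈ unshuffles k (N + 1) ↔ τ ∈ unshuffles k N := by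
  set p : Fin (N + 1) := ⟨k, Nat.lt_succ_of_le hk⟩ with hp
  have hlt : ∀ j : Fin N, (j : ℕ) < k → ((p.succAbove j : Fin (N + 1)) : ℕ) = j := fun j hj => by
    rw [Fin.succAbove_of_castSucc_lt _ _ (by simpa [Fin.lt_def, hp] using hj)]; rfl
  have hge : ∀ j : Fin N, k ≤ (j : ℕ) → ((p.succAbove j : Fin (N + 1)) : ℕ) = j + 1 :=
      fun j hj => by
    rw [Fin.succAbove_of_le_castSucc _ _ (by simpa [Fin.le_def, hp] using hj)]; rfl
  have hz := insertZero_self p τ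
  have hs := insertZero_succAbove p τ
  rw [mem_unshuffles, mem_unshuffles]
  constructor
  · rintro ⟨h1, h2⟩
    refine ⟨fun i j hij hj => ?_, fun i j hi hij => ?_⟩
    · have := h1 (p.succAbove i) (p.succAbove j) (p.strictMono_succAbove hij) (by rwa [hlt j hj])
      simpa [hs] using this
    · have := h2 (p.succAbove i) (p.succAbove j) (by rw [hge i hi]; omega)
        (p.strictMono_succAbove hij)
      simpa [hs] using this
  · rintro ⟨h1, h2⟩
    refine ⟨fun i j hij hj => ?_, fun i j hi hij => ?_⟩
    · obtain ⟨i, rfl⟩ := Fin.exists_succAbove_eq (x := i) (y := p) (by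
        rintro rfl; simp [Fin.lt_def, hp] at hij; omega)
      obtain ⟨j, rfl⟩ := Fin.exists_succAbove_eq (x := j) (y := p) (by
        rintro rfl; simp [hp] at hj)
      rw [hs, hs, Fin.succ_lt_succ_iff]
      have hij := p.strictMono_succAbove.lt_iff_lt.1 hij
      refine h1 i j hij ?_
      by_contra hc
      rw [hge j (not_lt.1 hc)] at hj; omega
    · obtain ⟨j, rfl⟩ := Fin.exists_succAbove_eq (x := j) (y := p) (by
        rintro rfl; simp [Fin.lt_def, hp] at hij; omega)
      rcases eq_or_ne i p with rfl | hip
      · rw [hz, hs]; exact Fin.succ_pos _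
      obtain ⟨i, rfl⟩ := Fin.exists_succAbove_eq hip
      rw [hs, hs, Fin.succ_lt_succ_iff]
      have hij := p.strictMono_succAbove.lt_iff_lt.1 hij
      refine h2 i j ?_ hij
      by_contra hc
      rw [hlt i (not_le.1 hc)] at hi; omega

/-- In an unshuffle the letter `0` starts one of the two blocks. -/
theorem insertZero_mem_imp {k N : ℕ} {p : Fin (N + 1)} {τ : Equiv.Perm (Fin N)}
    (h : insertZero p τ ∈ unshuffles k (N + 1)) : (p : ℕ) = k ∨ (p = 0 ∧ 0 < k) := by
  rw [mem_unshuffles] at h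
  have hz := insertZero_self p τ
  rcases lt_trichotomy (p : ℕ) k with hpk | hpk | hpk
  · right
    refine ⟨?_, by omega⟩
    by_contra hp
    have := h.1 0 p (Fin.pos_iff_ne_zero.2 hp) hpk
    rw [hz] at this
    exact absurd this (Fin.not_lt_zero _)
  · exact Or.inl hpk
  · have := h.2 ⟨k, by omega⟩ p le_rfl hpk
    rw [hz] at this
    exact absurd this (Fin.not_lt_zero _)

theorem sum_unshuffles_eq_sum_insertZero {A : Type*} [AddCommMonoid A] (k N : ℕ)
    (f : Equiv.Perm (Fin (N + 1)) → A) :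
    ∑ σ ∈ unshuffles k (N + 1), f σ = ∑ p : Fin (N + 1), ∑ τ : Equiv.Perm (Fin N),
      if insertZero p τ ∈ unshuffles k (N + 1) then f (insertZero p τ) else 0 := by
  rw [← Fintype.sum_prod_type' (f := fun p τ =>
      if insertZero p τ ∈ unshuffles k (N + 1) then f (insertZero p τ) else 0),
    (insertZero_bijective N).sum_comp
      (fun σ => if σ ∈ unshuffles k (N + 1) then f σ else 0), ← Finset.sum_filter]
  simp

theorem sum_unshuffles_zero_succ {A : Type*} [AddCommMonoid A] (N : ℕ)
    (f : Equiv.Perm (Fin (N + 1)) → A) :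
    ∑ σ ∈ unshuffles 0 (N + 1), f σ = ∑ τ ∈ unshuffles 0 N, f (insertZero 0 τ) := by
  rw [sum_unshuffles_eq_sum_insertZero, Finset.sum_eq_single 0]
  · rw [← Finset.sum_filter]
    exact Finset.sum_congr (by ext τ; simpa using insertZero_mem (Nat.zero_le N)) fun _ _ => rfl
  · intro p _ hp
    refine Finset.sum_eq_zero fun τ _ => if_neg fun h => ?_
    rcases insertZero_mem_imp h with h | h
    · exact hp (Fin.ext h)
    · exact hp h.1
  · simp

theorem sum_unshuffles_succ_self {A : Type*} [AddCommMonoid A] (N : ℕ)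
    (f : Equiv.Perm (Fin (N + 1)) → A) :
    ∑ σ ∈ unshuffles (N + 1) (N + 1), f σ = ∑ τ ∈ unshuffles N N, f (insertZero 0 τ) := by
  rw [sum_unshuffles_eq_sum_insertZero, Finset.sum_eq_single 0]
  · rw [← Finset.sum_filter]
    exact Finset.sum_congr (by ext τ; simpa using insertZero_zero_mem) fun _ _ => rfl
  · intro p _ hp
    refine Finset.sum_eq_zero fun τ _ => if_neg fun h => ?_
    rcases insertZero_mem_imp h with h | h
    · omega
    · exact hp h.1
  · simp

theorem sum_unshuffles_succ_succ {A : Type*} [AddCommMonoid A] {k N : ℕ} (hk : k + 1 ≤ N)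
    (f : Equiv.Perm (Fin (N + 1)) → A) :
    ∑ σ ∈ unshuffles (k + 1) (N + 1), f σ = ∑ τ ∈ unshuffles k N, f (insertZero 0 τ) +
      ∑ τ ∈ unshuffles (k + 1) N, f (insertZero ⟨k + 1, Nat.lt_succ_of_le hk⟩ τ) := by
  rw [sum_unshuffles_eq_sum_insertZero,
    Finset.sum_eq_add 0 ⟨k + 1, Nat.lt_succ_of_le hk⟩ (by simp [Fin.ext_iff])]
  · rw [← Finset.sum_filter, ← Finset.sum_filter]
    congr 1
    · exact Finset.sum_congr (by ext τ; simpa using insertZero_zero_mem) fun _ _ => rfl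
    · exact Finset.sum_congr (by ext τ; simpa using insertZero_mem hk) fun _ _ => rfl
  · intro p _ hp
    refine Finset.sum_eq_zero fun τ _ => if_neg fun h => ?_
    rcases insertZero_mem_imp h with h | h
    · exact hp.2 (Fin.ext h)
    · exact hp.1 h.1
  · simp
  · simp

/-- Relabelling a list by `insertZero p τ` relabels its tail by `τ` and moves its head to
position `p`. -/
theorem ofFn_insertZero {N : ℕ} {A : Type*} (g : Fin (N + 1) → A) (p : Fin (N + 1))
    (τ : Equiv.Perm (Fin N)) :
    List.ofFn (fun i => g (insertZero p τ i)) =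
      (List.ofFn fun i => g (τ i).succ).insertIdx p (g 0) := by
  refine List.ext_getElem (by simp [List.length_insertIdx, Nat.lt_succ_iff.1 p.2]) fun i h1 h2 => ?_
  have hi : i < N + 1 := by simpa using h1
  rw [List.getElem_ofFn, List.getElem_insertIdx]
  rcases eq_or_ne (⟨i, hi⟩ : Fin (N + 1)) p with rfl | hip
  · simp [insertZero_self]
  obtain ⟨j, hj⟩ := Fin.exists_succAbove_eq hip
  rw [← hj, insertZero_succAbove]
  have hj' : ((p.succAbove j : Fin (N + 1)) : ℕ) = i := by rw [hj]
  rcases lt_or_ge j.castSucc p with h | h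
  · rw [Fin.succAbove_of_castSucc_lt _ _ h] at hj'
    simp only [Fin.val_castSucc] at hj'
    have : i < p := by rw [Fin.lt_def] at h; simp at h; omega
    subst hj'
    simp [this]
  · rw [Fin.succAbove_of_le_castSucc _ _ h] at hj'
    simp only [Fin.val_succ] at hj'
    have : (p : ℕ) ≤ j := by rw [Fin.le_def] at h; simpa using h
    subst hj'
    simp [show ¬ ((j : ℕ) + 1 < p) by omega, show ¬ ((j : ℕ) + 1 = p) by omega]

/-! ### Mixed terms of a product of sums -/

/-- The part of the product `∏ (aᵢ + bᵢ)` over the list of pairs `(aᵢ, bᵢ)` which collects the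
words with `k` factors `aᵢ`, all factors kept in the order of the list. -/
def mixedTerm {R : Type*} [Ring R] : List (R × R) → ℕ → R
  | [], 0 => 1
  | [], _ + 1 => 0
  | x :: L, 0 => x.2 * mixedTerm L 0
  | x :: L, k + 1 => x.1 * mixedTerm L k + x.2 * mixedTerm L (k + 1)

section MixedTerm

variable {R : Type*} [Ring R]

theorem mixedTerm_eq_zero (L : List (R × R)) {k : ℕ} (hk : L.length < k) :
    mixedTerm L k = 0 := by
  induction L generalizing k with
  | nil => obtain ⟨k, rfl⟩ := Nat.exists_eq_succ_of_ne_zero hk.ne'; rfl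
  | cons x L ih =>
    obtain ⟨k, rfl⟩ := Nat.exists_eq_succ_of_ne_zero (Nat.ne_zero_of_lt hk)
    simp only [List.length_cons, Nat.succ_eq_add_one] at hk
    rw [Nat.succ_eq_add_one, mixedTerm, ih (by omega), ih (by omega)]; simp

theorem prod_add_eq_sum_mixedTerm (L : List (R × R)) :
    (L.map fun x => x.1 + x.2).prod = ∑ k ∈ Finset.range (L.length + 1), mixedTerm L k := by
  induction L with
  | nil => simp [mixedTerm]
  | cons x L ih =>
    rw [List.map_cons, List.prod_cons, ih, List.length_cons, Finset.sum_range_succ' _ (_ + 1),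
      add_mul]
    simp only [mixedTerm]
    rw [Finset.sum_add_distrib, add_assoc, ← Finset.mul_sum, ← Finset.mul_sum, ← mul_add,
      ← Finset.sum_range_succ' (fun k => mixedTerm L k), Finset.sum_range_succ _ (L.length + 1),
      mixedTerm_eq_zero L (Nat.lt_succ_self _), add_zero]

/-- A mixed term can be indexed by the number of either kind of factor. This lets the unshuffles
of `mixedTerm_ofFn` start with the block of either kind. -/
theorem mixedTerm_swap (L : List (R × R)) {j k : ℕ} (h : j + k = L.length) :
    mixedTerm (L.map Prod.swap) j = mixedTerm L k := by
  induction L generalizing j k with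
  | nil =>
    obtain ⟨rfl, rfl⟩ : j = 0 ∧ k = 0 := by simpa using h
    rfl
  | cons x L ih =>
    simp only [List.length_cons] at h
    rcases j with _ | j <;> rcases k with _ | k
    · omega
    · simp only [List.map_cons, mixedTerm, Prod.snd_swap]
      rw [ih (k := k) (by omega), mixedTerm_eq_zero L (k := k + 1) (by omega)]; simp
    · simp only [List.map_cons, mixedTerm, Prod.fst_swap, Prod.snd_swap]
      rw [ih (k := 0) (by omega), mixedTerm_eq_zero _ (k := j + 1) (by simp; omega)]; simp
    · simp only [List.map_cons, mixedTerm, Prod.fst_swap, Prod.snd_swap]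
      rw [ih (k := k + 1) (by omega), ih (k := k) (by omega), add_comm]

theorem mul_prod_of_anticomm {b : R} {l : List R} (h : ∀ a ∈ l, b * a = -(a * b)) :
    b * l.prod = (-1 : ℤ) ^ l.length • (l.prod * b) := by
  induction l with
  | nil => simp
  | cons a l ih =>
    rw [List.prod_cons, ← mul_assoc, h a (by simp), neg_mul, mul_assoc,
      ih fun c hc => h c (by simp [hc]), List.length_cons, pow_succ, mul_smul_comm, mul_assoc]
    simp

theorem take_insertIdx_self {A : Type*} (L : List A) {k : ℕ} (a : A) :
    (L.insertIdx k a).take k = L.take k :=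
  List.take_insertIdx_eq_take_of_le _ _ _ _ le_rfl

theorem drop_insertIdx_self {A : Type*} (L : List A) {k : ℕ} (a : A) (hk : k ≤ L.length) :
    (L.insertIdx k a).drop k = a :: L.drop k := by
  induction L generalizing k with
  | nil => obtain rfl : k = 0 := by simpa using hk
           simp
  | cons x L ih =>
    rcases k with _ | k
    · simp
    · simpa using ih (by simpa using hk)

/-- If the `aᵢ` anticommute with the `bⱼ`, sorting the words of a mixed term into unshuffles
produces the signs of the unshuffles. -/
theorem mixedTerm_ofFn {N k : ℕ} (hk : k ≤ N) (a b : Fin N → R)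
    (h : ∀ i j, b i * a j = -(a j * b i)) :
    mixedTerm (List.ofFn fun i => (a i, b i)) k = ∑ σ ∈ unshuffles k N,
      (Equiv.Perm.sign σ : ℤ) • (((List.ofFn fun i => a (σ i)).take k).prod *
        ((List.ofFn fun i => b (σ i)).drop k).prod) := by
  induction N generalizing k with
  | zero =>
    obtain rfl : k = 0 := by omega
    have : unshuffles 0 0 = {1} := by ext σ; simp [mem_unshuffles, Subsingleton.elim σ 1]
    simp [this, mixedTerm]
  | succ N ih =>
    have hfirst : ∀ (k : ℕ) (τ : Equiv.Perm (Fin N)),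
        (Equiv.Perm.sign (insertZero 0 τ) : ℤ) •
          (((List.ofFn fun i => a (insertZero 0 τ i)).take (k + 1)).prod *
          ((List.ofFn fun i => b (insertZero 0 τ i)).drop (k + 1)).prod) =
        a 0 * ((Equiv.Perm.sign τ : ℤ) • (((List.ofFn fun i => a (τ i).succ).take k).prod *
          ((List.ofFn fun i => b (τ i).succ).drop k).prod)) := fun k τ => by
      rw [ofFn_insertZero, ofFn_insertZero, sign_insertZero, mul_smul_comm]
      simp [mul_assoc]
    -- Moving `b 0` past the `k` factors `a` gives the sign `(-1) ^ k` of the cycle in `insertZero`.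
    have hsecond : ∀ (k : ℕ) (hk : k ≤ N) (τ : Equiv.Perm (Fin N)),
        (Equiv.Perm.sign (insertZero ⟨k, Nat.lt_succ_of_le hk⟩ τ) : ℤ) •
          (((List.ofFn fun i => a (insertZero ⟨k, Nat.lt_succ_of_le hk⟩ τ i)).take k).prod *
          ((List.ofFn fun i => b (insertZero ⟨k, Nat.lt_succ_of_le hk⟩ τ i)).drop k).prod) =
        b 0 * ((Equiv.Perm.sign τ : ℤ) • (((List.ofFn fun i => a (τ i).succ).take k).prod *
          ((List.ofFn fun i => b (τ i).succ).drop k).prod)) := fun k hk τ => by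
      rw [ofFn_insertZero, ofFn_insertZero, sign_insertZero]
      simp only
      rw [take_insertIdx_self, drop_insertIdx_self _ _ (by simpa using hk), List.prod_cons,
        mul_smul_comm, ← mul_assoc (b 0),
        mul_prod_of_anticomm (b := b 0) (l := (List.ofFn fun i => a (τ i).succ).take k)]
      · have : ((List.ofFn fun i => a (τ i).succ).take k).length = k := by simpa using hk
        rw [this, smul_mul_assoc, smul_smul, mul_assoc]
        congr 1
        push_cast
        ring
      · intro c hc
        obtain ⟨i, rfl⟩ := (List.mem_ofFn' _ _).1 (List.mem_of_mem_take hc)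
        exact h _ _
    have ih' := fun (k : ℕ) (hk : k ≤ N) =>
      ih hk (fun i => a i.succ) (fun i => b i.succ) fun i j => h _ _
    rw [List.ofFn_succ]
    rcases k with _ | k
    · rw [mixedTerm, ih' 0 (Nat.zero_le _), sum_unshuffles_zero_succ, Finset.mul_sum]
      exact Finset.sum_congr rfl fun τ _ => (hsecond 0 (Nat.zero_le _) τ).symm
    · rw [mixedTerm, ih' k (by omega), Finset.mul_sum]
      rcases eq_or_lt_of_le (Nat.succ_le_succ_iff.1 hk) with rfl | hlt
      · rw [mixedTerm_eq_zero _ (by simp), mul_zero, add_zero, sum_unshuffles_succ_self]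
        exact Finset.sum_congr rfl fun τ _ => (hfirst k τ).symm
      · rw [ih' (k + 1) hlt, Finset.mul_sum, sum_unshuffles_succ_succ hlt]
        exact congrArg₂ (· + ·) (Finset.sum_congr rfl fun τ _ => (hfirst k τ).symm)
          (Finset.sum_congr rfl fun τ _ => (hsecond (k + 1) hlt τ).symm)

end MixedTerm

/-! ### Iterated contractions -/

open CliffordAlgebra (contractLeft contractRight involute)
open scoped TensorProduct

section Contraction

variable {K : Type*} [Field K] {V : Type*} [AddCommGroup V] [Module K V]

/-- Sign scalars in the field agree with sign scalars in `ℤ`, the ones used for permutations. -/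
theorem neg_one_pow_smul {A : Type*} [AddCommGroup A] [Module K A] (p : ℕ) (x : A) :
    ((-1 : K) ^ p) • x = (-1 : ℤ) ^ p • x := by
  rcases Nat.even_or_odd p with h | h <;> simp [h.neg_one_pow]

/-- The composition `ι_{x₁} ⋯ ι_{x_p}` of the left contractions with `B x₁, …, B x_p` on `⋀ V`. -/
def iterContract (B : LinearMap.BilinForm K V) (l : List V) :
    Module.End K (ExteriorAlgebra K V) :=
  (l.map fun x => contractLeft (Q := 0) (B x)).prod

variable (B : LinearMap.BilinForm K V)

@[simp]
theorem iterContract_nil (u : ExteriorAlgebra K V) : iterContract B [] u = u := rfl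

@[simp]
theorem iterContract_cons (x : V) (l : List V) (u : ExteriorAlgebra K V) :
    iterContract B (x :: l) u = contractLeft (B x) (iterContract B l u) := by
  simp [iterContract]

theorem iterContract_append (l l' : List V) (u : ExteriorAlgebra K V) :
    iterContract B (l ++ l') u = iterContract B l (iterContract B l' u) := by
  simp [iterContract]

theorem iterPoissonBracket_eq [FiniteDimensional K V] (hB : B.IsSymm) {p : ℕ} (a : Fin p → V)
    (w : ExteriorAlgebra K V) :
    iterPoissonBracket B a w = iterContract B (List.ofFn a) w := by
  rw [iterPoissonBracket]
  induction List.ofFn a with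
  | nil => rfl
  | cons x l ih => rw [List.foldr_cons, ih, poissonBracket_ι_left B hB, iterContract_cons]

theorem iterContract_contractLeft (l : List V) (d : Module.Dual K V) (u : ExteriorAlgebra K V) :
    iterContract B l (contractLeft d u) =
      (-1 : ℤ) ^ l.length • contractLeft d (iterContract B l u) := by
  induction l with
  | nil => simp
  | cons x l ih =>
    rw [iterContract_cons, ih, map_zsmul, CliffordAlgebra.contractLeft_comm, iterContract_cons,
      List.length_cons, pow_succ]
    simp

theorem iterContract_comm (l l' : List V) (u : ExteriorAlgebra K V) :
    iterContract B l (iterContract B l' u) =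
      (-1 : ℤ) ^ (l.length * l'.length) • iterContract B l' (iterContract B l u) := by
  induction l' with
  | nil => simp
  | cons x l' ih =>
    rw [iterContract_cons, iterContract_contractLeft, ih, iterContract_cons, map_zsmul, smul_smul,
      List.length_cons, mul_add, mul_one, pow_add, mul_comm]

variable {B}

theorem iterContract_mem {p : ℕ} {u : ExteriorAlgebra K V} (hu : u ∈ ⋀[K]^p V) (l : List V) :
    iterContract B l u ∈ ⋀[K]^(p - l.length) V := by
  induction l with
  | nil => exact hu
  | cons x l ih =>
    rw [iterContract_cons]
    exact contractLeft_mem _ ih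

theorem exists_algebraMap_of_mem {u : ExteriorAlgebra K V} (hu : u ∈ ⋀[K]^0 V) :
    ∃ c : K, algebraMap K _ c = u := Submodule.mem_one.1 (by simpa using hu)

theorem exists_ι_of_mem {u : ExteriorAlgebra K V} (hu : u ∈ ⋀[K]^1 V) :
    ∃ x : V, ExteriorAlgebra.ι K x = u := by
  rw [ExteriorAlgebra.exteriorPower, pow_one] at hu
  exact hu

theorem contractLeft_eq_zero (d : Module.Dual K V) {u : ExteriorAlgebra K V}
    (hu : u ∈ ⋀[K]^0 V) : contractLeft d u = 0 := by
  obtain ⟨c, rfl⟩ := exists_algebraMap_of_mem hu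
  exact CliffordAlgebra.contractLeft_algebraMap ..

theorem iterContract_eq_zero {p : ℕ} {u : ExteriorAlgebra K V} (hu : u ∈ ⋀[K]^p V) {l : List V}
    (hl : p < l.length) : iterContract B l u = 0 := by
  induction l with
  | nil => simp at hl
  | cons x l ih =>
    rw [iterContract_cons]
    rcases (Nat.lt_succ_iff.1 hl).eq_or_lt with rfl | h
    · exact contractLeft_eq_zero _ (by simpa using iterContract_mem (B := B) hu l)
    · rw [ih h, map_zero]

theorem involute_of_mem {p : ℕ} {u : ExteriorAlgebra K V} (hu : u ∈ ⋀[K]^p V) :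
    involute u = (-1 : ℤ) ^ p • u := by
  induction hu using Submodule.pow_induction_on_left' with
  | algebraMap r => simp
  | add a b i ha hb iha ihb => rw [map_add, iha, ihb, smul_add]
  | mem_mul m hm i a ha ih =>
    obtain ⟨y, rfl⟩ := hm
    rw [map_mul, ExteriorAlgebra.ι, CliffordAlgebra.involute_ι, ih, Nat.succ_eq_add_one, pow_succ,
      mul_smul_comm]
    simp

theorem involute_pow_of_mem {p : ℕ} {u : ExteriorAlgebra K V} (hu : u ∈ ⋀[K]^p V) (k : ℕ) :
    ((involute : ExteriorAlgebra K V →ₐ[K] _).toLinearMap ^ k) u = (-1 : ℤ) ^ (p * k) • u := by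
  induction k with
  | zero => simp
  | succ k ih =>
    rw [pow_succ', Module.End.mul_apply, ih, map_zsmul, AlgHom.toLinearMap_apply,
      involute_of_mem hu, smul_smul, ← pow_add, mul_add, mul_one]

theorem involute_contractLeft (d : Module.Dual K V) (u : ExteriorAlgebra K V) :
    involute (contractLeft d u) = -contractLeft d (involute u) := by
  induction u using CliffordAlgebra.left_induction with
  | algebraMap r => simp [CliffordAlgebra.contractLeft_algebraMap]
  | add x y hx hy => simp only [map_add, hx, hy, neg_add]
  | ι_mul x y hx =>
    simp only [CliffordAlgebra.contractLeft_ι_mul, map_sub, map_smul, map_mul,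
      CliffordAlgebra.involute_ι, hx, neg_mul, map_neg]
    simp [sub_eq_add_neg]

theorem contractLeft_mul (d : Module.Dual K V) (u w : ExteriorAlgebra K V) :
    contractLeft d (u * w) = contractLeft d u * w + involute u * contractLeft d w := by
  induction u using CliffordAlgebra.left_induction with
  | algebraMap r =>
    simp [CliffordAlgebra.contractLeft_algebraMap, CliffordAlgebra.contractLeft_algebraMap_mul]
  | add x y hx hy => simp only [add_mul, map_add, hx, hy]; abel
  | ι_mul x y hx =>
    rw [mul_assoc, CliffordAlgebra.contractLeft_ι_mul, hx, CliffordAlgebra.contractLeft_ι_mul,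
      map_mul, CliffordAlgebra.involute_ι]
    simp only [mul_add, sub_mul, smul_mul_assoc, mul_assoc, neg_mul]
    abel

/-! ### Contractions of a product -/

variable (B)

/-- The contraction with `B x` in the first factor of `⋀ V ⊗ ⋀ V`. -/
noncomputable def contractFst (x : V) :
    Module.End K (ExteriorAlgebra K V ⊗[K] ExteriorAlgebra K V) :=
  TensorProduct.map (contractLeft (Q := 0) (B x)) LinearMap.id

/-- The contraction with `B x` in the second factor of `⋀ V ⊗ ⋀ V`, with the sign that an odd
operator acquires by passing the first factor. -/
noncomputable def contractSnd (x : V) :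
    Module.End K (ExteriorAlgebra K V ⊗[K] ExteriorAlgebra K V) :=
  TensorProduct.map (involute (Q := 0)).toLinearMap (contractLeft (Q := 0) (B x))

theorem contractSnd_mul_contractFst (x y : V) :
    contractSnd B x * contractFst B y = -(contractFst B y * contractSnd B x) := by
  refine TensorProduct.ext' fun u w => ?_
  simp [contractFst, contractSnd, involute_contractLeft, TensorProduct.neg_tmul]

theorem contractFst_mul_contractSnd (x y : V) :
    contractFst B x * contractSnd B y = -(contractSnd B y * contractFst B x) := by
  rw [contractSnd_mul_contractFst, neg_neg]

theorem prod_contractFst_tmul (l : List V) (u w : ExteriorAlgebra K V) :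
    (l.map (contractFst B)).prod (u ⊗ₜ w) = iterContract B l u ⊗ₜ w := by
  induction l with
  | nil => simp
  | cons x l ih => simp [ih, contractFst]

theorem prod_contractSnd_tmul (l : List V) (u w : ExteriorAlgebra K V) :
    (l.map (contractSnd B)).prod (u ⊗ₜ w) =
      ((involute : ExteriorAlgebra K V →ₐ[K] _).toLinearMap ^ l.length) u ⊗ₜ
        iterContract B l w := by
  induction l with
  | nil => simp
  | cons x l ih => simp [ih, contractSnd, pow_succ']

/-- The contraction of a product is induced by the sum of the contractions of its factors. -/
theorem iterContract_mul' (l : List V) (t : ExteriorAlgebra K V ⊗[K] ExteriorAlgebra K V) :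
    iterContract B l (LinearMap.mul' K (ExteriorAlgebra K V) t) =
      LinearMap.mul' K (ExteriorAlgebra K V)
        ((l.map fun x => contractFst B x + contractSnd B x).prod t) := by
  induction l with
  | nil => simp
  | cons x l ih =>
    rw [iterContract_cons, ih, List.map_cons, List.prod_cons, Module.End.mul_apply]
    generalize (l.map fun x => contractFst B x + contractSnd B x).prod t = t
    induction t with
    | zero => simp
    | add s t hs ht => simp only [map_add, hs, ht]
    | tmul u w => simp [contractFst, contractSnd, contractLeft_mul]

end Contraction

/-! ### Contractions of the Poisson bracket -/

section BracketFormula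

variable {K : Type*} [Field K] {V : Type*} [AddCommGroup V] [Module K V]
variable {B : LinearMap.BilinForm K V}

theorem contractRight_mem {p : ℕ} {v : ExteriorAlgebra K V} (hv : v ∈ ⋀[K]^(p + 1) V)
    (d : Module.Dual K V) : contractRight v d ∈ ⋀[K]^p V := by
  rw [contractRight_of_mem d hv]
  exact Submodule.smul_mem _ _ (contractLeft_mem d hv)

/-- The insertion `L[P]` in terms of the elements `v`, `w` from which `L`, `P` are derived. -/
theorem ι_insertion {s k N : ℕ} (hs : 0 < s) (hN : s + k - 1 = N) {L : V [⋀^Fin s]→ₗ[K] V}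
    {P : V [⋀^Fin k]→ₗ[K] V} {v w : ExteriorAlgebra K V}
    (hL : ∀ c, ExteriorAlgebra.ι K (L c) = iterContract B (List.ofFn c) v)
    (hP : ∀ c, ExteriorAlgebra.ι K (P c) = iterContract B (List.ofFn c) w) (x : Fin N → V) :
    ExteriorAlgebra.ι K (insertion hs L P fun i => x (Fin.cast hN i)) =
      ∑ σ ∈ unshuffles k N, (Equiv.Perm.sign σ : ℤ) •
        contractLeft (B (ExteriorAlgebra.ιInv
            (iterContract B ((List.ofFn fun i => x (σ i)).take k) w)))
          (iterContract B ((List.ofFn fun i => x (σ i)).drop k) v) := by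
  subst hN
  obtain ⟨s, rfl⟩ := Nat.exists_eq_succ_of_ne_zero hs.ne'
  rw [insertion, map_sum]
  refine Finset.sum_congr rfl fun σ _ => ?_
  rw [map_zsmul, hL, List.ofFn_succ, iterContract_cons]
  congr 4
  · rw [dif_pos (by simp), ← ExteriorAlgebra.ι_leftInverse (R := K) (P _), hP]
    congr 3
    refine List.ext_getElem (by simp) fun i h1 h2 => ?_
    simp
  · refine List.ext_getElem (by simp) fun i h1 h2 => ?_
    simp

variable [FiniteDimensional K V]

theorem contractLeft_eq_sum (hB : B.IsSymm) (x : V) (u : ExteriorAlgebra K V) :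
    contractLeft (B x) u = ∑ i, B (Module.finBasis K V i) x •
      contractLeft ((Module.finBasis K V).coord i) u := by
  have h : B x = ∑ i, B (Module.finBasis K V i) x • (Module.finBasis K V).coord i := by
    refine (Module.finBasis K V).ext fun j => ?_
    simp [Finsupp.single_apply, hB.eq x]
  conv_lhs => rw [h]
  simp

theorem contractLeft_eq_sum_coord (x : V) (u : ExteriorAlgebra K V) :
    contractLeft (B x) u = ∑ i, (Module.finBasis K V).coord i x •
      contractLeft (B (Module.finBasis K V i)) u := by
  have h : B x = ∑ i, (Module.finBasis K V).coord i x • B (Module.finBasis K V i) := by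
    conv_lhs => rw [← (Module.finBasis K V).sum_repr x, map_sum]
    simp
  conv_lhs => rw [h]
  simp

variable (B) in
/-- The tensor `∑ i, (v ⌊ B(e i, ·)) ⊗ (eⁱ ⌋ w)`, whose image in `⋀ V` is the bracket `[v, w]`. -/
noncomputable def bracketTensor (v w : ExteriorAlgebra K V) :
    ExteriorAlgebra K V ⊗[K] ExteriorAlgebra K V :=
  ∑ i, contractRight v (B (Module.finBasis K V i)) ⊗ₜ
    contractLeft ((Module.finBasis K V).coord i) w

theorem mul'_bracketTensor (v w : ExteriorAlgebra K V) :
    LinearMap.mul' K (ExteriorAlgebra K V) (bracketTensor B v w) = poissonBracket B v w := by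
  simp [bracketTensor, poissonBracket_apply]

/-- The words that contract the first factor down to a scalar. -/
theorem mul'_contractFst_contractSnd (hB : B.IsSymm) {s : ℕ} {v : ExteriorAlgebra K V}
    (hv : v ∈ ⋀[K]^(s + 1) V) (w : ExteriorAlgebra K V) (l₁ l₂ : List V) (hl₁ : l₁.length = s) :
    LinearMap.mul' K (ExteriorAlgebra K V) (((l₁.map (contractFst B)).prod *
        (l₂.map (contractSnd B)).prod) (bracketTensor B v w)) =
      (-1 : ℤ) ^ ((s + 1) * l₂.length) •
        contractLeft (B (ExteriorAlgebra.ιInv (iterContract B l₁ v))) (iterContract B l₂ w) := by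
  obtain ⟨y, hy⟩ := exists_ι_of_mem (by simpa [hl₁] using iterContract_mem (B := B) hv l₁)
  rw [← hy, ExteriorAlgebra.ι_leftInverse, contractLeft_eq_sum hB, Finset.smul_sum, bracketTensor,
    map_sum, map_sum]
  refine Finset.sum_congr rfl fun i _ => ?_
  rw [Module.End.mul_apply, prod_contractSnd_tmul, prod_contractFst_tmul, LinearMap.mul'_apply,
    involute_pow_of_mem (contractRight_mem hv _), contractRight_of_mem _ hv, map_zsmul, map_smul,
    iterContract_contractLeft, iterContract_contractLeft, ← hy, neg_one_pow_smul, ExteriorAlgebra.ι,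
    CliffordAlgebra.contractLeft_ι, hl₁]
  simp only [smul_mul_assoc, mul_smul_comm, smul_smul, ← Algebra.smul_def]
  congr 1
  rcases Nat.even_or_odd s with hs | hs <;> rcases Nat.even_or_odd l₂.length with h | h <;>
    simp [pow_succ, pow_mul, add_mul, pow_add, hs.neg_one_pow, h.neg_one_pow]

/-- The words that contract the second factor down to a scalar. -/
theorem mul'_contractSnd_contractFst {k j : ℕ} {v w : ExteriorAlgebra K V}
    (hv : v ∈ ⋀[K]^(j + 2) V) (hw : w ∈ ⋀[K]^(k + 1) V) (l₁ l₂ : List V) (hl₁ : l₁.length = k)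
    (hl₂ : l₂.length = j) :
    LinearMap.mul' K (ExteriorAlgebra K V) (((l₁.map (contractSnd B)).prod *
        (l₂.map (contractFst B)).prod) (bracketTensor B v w)) =
      -contractLeft (B (ExteriorAlgebra.ιInv (iterContract B l₁ w))) (iterContract B l₂ v) := by
  obtain ⟨y, hy⟩ := exists_ι_of_mem (by simpa [hl₁] using iterContract_mem (B := B) hw l₁)
  rw [← hy, ExteriorAlgebra.ι_leftInverse, contractLeft_eq_sum_coord, ← Finset.sum_neg_distrib,
    bracketTensor, map_sum, map_sum]
  refine Finset.sum_congr rfl fun i _ => ?_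
  have h1 : iterContract B l₂ (contractRight v (B (Module.finBasis K V i))) ∈ ⋀[K]^1 V := by
    simpa [hl₂] using iterContract_mem (B := B)
      (contractRight_mem hv (B (Module.finBasis K V i))) l₂
  rw [Module.End.mul_apply, prod_contractFst_tmul, prod_contractSnd_tmul, LinearMap.mul'_apply,
    involute_pow_of_mem h1, contractRight_of_mem _ hv, map_smul,
    iterContract_contractLeft, iterContract_contractLeft, ← hy, neg_one_pow_smul, ExteriorAlgebra.ι,
    CliffordAlgebra.contractLeft_ι, hl₁, hl₂]
  simp only [mul_smul_comm, smul_smul, ← Algebra.commutes, ← Algebra.smul_def]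
  rcases Nat.even_or_odd k with hs | hs <;> rcases Nat.even_or_odd j with h | h <;>
    simp [pow_succ, hs.neg_one_pow, h.neg_one_pow]

/-- For degree reasons, only two mixed terms contribute to a contraction of the bracket down to
degree one. -/
theorem mixedTerm_bracketTensor_eq_zero {s k N j : ℕ} (hN : s + k = N)
    {v w : ExteriorAlgebra K V} (hv : v ∈ ⋀[K]^(s + 2) V) (hw : w ∈ ⋀[K]^(k + 1) V)
    (x : Fin N → V) (hj : j ≤ N) (hjs : j ≠ s) (hjs' : j ≠ s + 1) :
    mixedTerm (List.ofFn fun i => (contractFst B (x i), contractSnd B (x i))) j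
      (bracketTensor B v w) = 0 := by
  rw [mixedTerm_ofFn hj _ _ fun _ _ => contractSnd_mul_contractFst B _ _, LinearMap.sum_apply]
  refine Finset.sum_eq_zero fun σ _ => ?_
  have hmap : ∀ f : V → Module.End K (ExteriorAlgebra K V ⊗[K] ExteriorAlgebra K V),
      (List.ofFn fun i => f (x (σ i))) = (List.ofFn fun i => x (σ i)).map f := fun f => by
    rw [List.map_ofFn]; rfl
  rw [hmap, hmap, ← List.map_take, ← List.map_drop, LinearMap.smul_apply, bracketTensor, map_sum,
    Finset.sum_eq_zero, smul_zero]
  intro i _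
  rw [Module.End.mul_apply, prod_contractSnd_tmul, prod_contractFst_tmul,
    involute_pow_of_mem (contractRight_mem hv _), map_zsmul]
  rcases lt_or_gt_of_ne hjs with h | h
  · rw [iterContract_eq_zero (contractLeft_mem _ hw) (by simp; omega), TensorProduct.tmul_zero]
  · rw [iterContract_eq_zero (contractRight_mem hv _) (by simp; omega), smul_zero,
      TensorProduct.zero_tmul]

/-- Contracting the Poisson bracket of `v` and `w` down to degree one gives, up to sign, the
Nijenhuis-Richardson bracket of the maps derived from `v` and `w`. -/
theorem iterContract_poissonBracket (hB : B.IsSymm) {s k N : ℕ} (hs : 0 < s) (hk : 0 < k)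
    (hN : s + k - 1 = N) {L : V [⋀^Fin s]→ₗ[K] V} {P : V [⋀^Fin k]→ₗ[K] V}
    {v w : ExteriorAlgebra K V} (hv : v ∈ ⋀[K]^(s + 1) V) (hw : w ∈ ⋀[K]^(k + 1) V)
    (hL : ∀ c, ExteriorAlgebra.ι K (L c) = iterContract B (List.ofFn c) v)
    (hP : ∀ c, ExteriorAlgebra.ι K (P c) = iterContract B (List.ofFn c) w) (x : Fin N → V) :
    iterContract B (List.ofFn x) (poissonBracket B v w) =
      -((-1 : ℤ) ^ ((s - 1) * (k - 1)) • ExteriorAlgebra.ι K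
        (nijenhuisRichardson hs hk L P fun i => x (Fin.cast hN i))) := by
  have hmap : ∀ (f : V → Module.End K (ExteriorAlgebra K V ⊗[K] ExteriorAlgebra K V))
      (σ : Equiv.Perm (Fin N)),
      (List.ofFn fun i => f (x (σ i))) = (List.ofFn fun i => x (σ i)).map f := fun f σ => by
    rw [List.map_ofFn]; rfl
  have hPL : ExteriorAlgebra.ι K
      (insertion hk P L fun i => x (Fin.cast hN (Fin.cast (by omega) i))) = _ :=
    ι_insertion (N := N) hk (by omega) hP hL x
  have hprod : ((List.ofFn x).map fun x => contractFst B x + contractSnd B x) =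
      (List.ofFn fun i => (contractFst B (x i), contractSnd B (x i))).map
        fun y => y.1 + y.2 := by
    simp [List.map_ofFn, Function.comp_def]
  rw [nijenhuisRichardson, map_sub, map_zsmul, ι_insertion hs hN hL hP,
    hPL, ← mul'_bracketTensor, iterContract_mul', hprod,
    prod_add_eq_sum_mixedTerm, LinearMap.sum_apply, map_sum, List.length_ofFn,
    Finset.sum_eq_add (s - 1) s (by omega)]
  -- The part with `s - 1` contractions of `v` yields `L[P]`. Insertion lists the arguments of the
  -- inner map first, so this part is indexed by its `k` contractions of `w` instead.
  · have hswap : mixedTerm (List.ofFn fun i => (contractFst B (x i), contractSnd B (x i))) (s - 1) =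
        mixedTerm (List.ofFn fun i => (contractSnd B (x i), contractFst B (x i))) k := by
      rw [← mixedTerm_swap (j := k) _ (by simp; omega)]
      simp [List.map_ofFn, Function.comp_def]
    rw [hswap, mixedTerm_ofFn (by omega) _ _ fun _ _ => contractFst_mul_contractSnd B _ _,
      mixedTerm_ofFn (by omega) _ _ fun _ _ => contractSnd_mul_contractFst B _ _,
      LinearMap.sum_apply, LinearMap.sum_apply, map_sum, map_sum, smul_sub, smul_smul, ← pow_add,
      Even.neg_one_pow ⟨_, rfl⟩, one_smul, neg_sub, sub_eq_add_neg, add_comm, Finset.smul_sum,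
      ← Finset.sum_neg_distrib]
    congr 1
    · refine Finset.sum_congr rfl fun σ _ => ?_
      rw [hmap, hmap, ← List.map_take, ← List.map_drop, LinearMap.smul_apply, map_zsmul,
        mul'_contractFst_contractSnd hB hv w _ _ (by simp; omega), smul_comm]
      congr 1
      obtain ⟨s, rfl⟩ := Nat.exists_eq_succ_of_ne_zero hs.ne'
      have : (List.drop (s + 1) (List.ofFn fun i => x (σ i))).length = k - 1 := by simp; omega
      rw [Nat.succ_eq_add_one, this, Nat.add_sub_cancel, add_assoc, add_mul, pow_add,
        Even.neg_one_pow ((by decide : Even (1 + 1)).mul_right _), mul_one]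
    · refine Finset.sum_congr rfl fun σ _ => ?_
      rw [hmap, hmap, ← List.map_take, ← List.map_drop, LinearMap.smul_apply, map_zsmul,
        mul'_contractSnd_contractFst (j := s - 1) (by convert hv using 2; omega) hw _ _
          (by simp; omega) (by simp; omega), smul_neg]
  · intro j hj hne
    rw [mixedTerm_bracketTensor_eq_zero (s := s - 1) (k := k) (by omega)
      (by convert hv using 2; omega) hw x (Nat.lt_succ_iff.1 (Finset.mem_range.1 hj)) hne.1
      (by omega), map_zero]
  · simp; omega
  · simp; omega

end BracketFormula

/-! ### Duality by contraction -/

section ContractPairing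

variable {K : Type*} [Field K] {V : Type*} [AddCommGroup V] [Module K V]
  (B : LinearMap.BilinForm K V)

/-- The action of `⋀ V` on itself by contractions, extending `x ↦ B x ⌋ ·`. -/
noncomputable def contractHom : ExteriorAlgebra K V →ₐ[K] Module.End K (ExteriorAlgebra K V) :=
  ExteriorAlgebra.lift K ⟨(contractLeft (Q := (0 : QuadraticForm K V))) ∘ₗ B, fun _ =>
    LinearMap.ext fun _ => CliffordAlgebra.contractLeft_contractLeft _ _⟩

theorem contractHom_ιMulti {p : ℕ} (x : Fin p → V) :
    contractHom B (ExteriorAlgebra.ιMulti K p x) = iterContract B (List.ofFn x) := by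
  rw [ExteriorAlgebra.ιMulti_apply, map_list_prod, iterContract, List.map_ofFn, List.map_ofFn]
  congr 2
  funext i
  simp [contractHom]

/-- The pairing of `⋀ᵖ V` with itself by contraction. -/
noncomputable def contractPairing (p : ℕ) : ⋀[K]^p V →ₗ[K] Module.Dual K (⋀[K]^p V) :=
  LinearMap.mk₂ K (fun u y => ExteriorAlgebra.algebraMapInv
      (contractHom B (y : ExteriorAlgebra K V) (u : ExteriorAlgebra K V)))
    (by intros; simp) (by intros; simp) (by intros; simp) (by intros; simp)

variable {B}

theorem algebraMap_contractPairing_ιMulti {p : ℕ} (u : ⋀[K]^p V) (x : Fin p → V) :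
    algebraMap K (ExteriorAlgebra K V) (contractPairing B p u (exteriorPower.ιMulti K p x)) =
      iterContract B (List.ofFn x) u := by
  obtain ⟨c, hc⟩ := exists_algebraMap_of_mem
    (by simpa using iterContract_mem (B := B) u.2 (List.ofFn x))
  simp only [contractPairing, LinearMap.mk₂_apply, exteriorPower.ιMulti_apply_coe]
  rw [contractHom_ιMulti, ← hc, ExteriorAlgebra.algebraMap_leftInverse V c]

end ContractPairing

section Duality

variable {K : Type*} [Field K] {V : Type*} [AddCommGroup V] [Module K V] [FiniteDimensional K V]

/-- Euler's identity `∑ i, e i * (eⁱ ⌋ u) = p u` for `u` of degree `p`. -/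
theorem sum_ι_mul_contractLeft {p : ℕ} {u : ExteriorAlgebra K V} (hu : u ∈ ⋀[K]^p V) :
    ∑ i, ExteriorAlgebra.ι K (Module.finBasis K V i) *
      contractLeft ((Module.finBasis K V).coord i) u = (p : K) • u := by
  induction hu using Submodule.pow_induction_on_left' with
  | algebraMap r => simp [CliffordAlgebra.contractLeft_algebraMap]
  | add a b i ha hb iha ihb =>
    simp only [map_add, mul_add, Finset.sum_add_distrib, iha, ihb, smul_add]
  | mem_mul m hm i a ha ih =>
    obtain ⟨y, rfl⟩ := hm
    have hy : ∑ i, ((Module.finBasis K V).coord i y) •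
        ExteriorAlgebra.ι K (Module.finBasis K V i) = ExteriorAlgebra.ι K y := by
      conv_rhs => rw [← (Module.finBasis K V).sum_repr y, map_sum]
      simp
    have hswap : ∀ j, ExteriorAlgebra.ι K (Module.finBasis K V j) *
        (ExteriorAlgebra.ι K y * contractLeft ((Module.finBasis K V).coord j) a) =
        -(ExteriorAlgebra.ι K y * (ExteriorAlgebra.ι K (Module.finBasis K V j) *
          contractLeft ((Module.finBasis K V).coord j) a)) := fun j => by
      rw [← mul_assoc, eq_neg_of_add_eq_zero_left (ExteriorAlgebra.ι_add_mul_swap (R := K) _ y),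
        neg_mul, mul_assoc]
    have hterm : ∀ j, ExteriorAlgebra.ι K (Module.finBasis K V j) *
        contractLeft ((Module.finBasis K V).coord j) (ExteriorAlgebra.ι K y * a) =
        ((Module.finBasis K V).coord j y • ExteriorAlgebra.ι K (Module.finBasis K V j)) * a +
        ExteriorAlgebra.ι K y * (ExteriorAlgebra.ι K (Module.finBasis K V j) *
          contractLeft ((Module.finBasis K V).coord j) a) := fun j => by
      conv_lhs => rw [ExteriorAlgebra.ι, CliffordAlgebra.contractLeft_ι_mul, mul_sub]
      rw [hswap, sub_neg_eq_add, mul_smul_comm, smul_mul_assoc]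
    rw [Finset.sum_congr rfl fun j _ => hterm j, Finset.sum_add_distrib, ← Finset.sum_mul, hy,
      ← Finset.mul_sum, ih, mul_smul_comm, Nat.cast_succ, add_smul, one_smul, add_comm]

variable {B : LinearMap.BilinForm K V}

theorem eq_zero_of_contractLeft_eq_zero [CharZero K] (hnd : B.Nondegenerate) {p : ℕ}
    {u : ExteriorAlgebra K V} (hu : u ∈ ⋀[K]^(p + 1) V) (h : ∀ x, contractLeft (B x) u = 0) :
    u = 0 := by
  have hE := sum_ι_mul_contractLeft hu
  rw [Finset.sum_eq_zero] at hE
  · exact (smul_eq_zero.1 hE.symm).resolve_left (Nat.cast_ne_zero.2 p.succ_ne_zero)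
  · intro i _
    obtain ⟨x, hx⟩ := (B.toDual hnd).surjective ((Module.finBasis K V).coord i)
    have hx' : B x = (Module.finBasis K V).coord i := by
      rw [← hx]; ext y; simp [LinearMap.BilinForm.toDual_def]
    rw [← hx', h, mul_zero]

/-- A form is determined by its contractions with a fixed number of vectors, at most its degree. -/
theorem eq_zero_of_iterContract_eq_zero [CharZero K] (hnd : B.Nondegenerate) {p q : ℕ}
    (hq : q ≤ p) {u : ExteriorAlgebra K V} (hu : u ∈ ⋀[K]^p V)
    (h : ∀ x : Fin q → V, iterContract B (List.ofFn x) u = 0) : u = 0 := by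
  induction q generalizing p u with
  | zero => simpa using h Fin.elim0
  | succ q ih =>
    obtain ⟨p, rfl⟩ := Nat.exists_eq_succ_of_ne_zero (Nat.ne_zero_of_lt hq)
    refine eq_zero_of_contractLeft_eq_zero hnd hu fun y =>
      ih (Nat.succ_le_succ_iff.1 hq) (contractLeft_mem _ hu) fun x => ?_
    have hx := h (Fin.snoc x y)
    rw [List.ofFn_succ'] at hx
    simpa [iterContract_append] using hx

/-- Every alternating form is given by contraction of an element of the exterior power: the
contraction pairing is injective, hence bijective. -/
theorem exists_iterContract_eq [CharZero K] (hnd : B.Nondegenerate) {p : ℕ}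
    (f : V [⋀^Fin p]→ₗ[K] K) : ∃ u : ⋀[K]^p V, ∀ x : Fin p → V,
      iterContract B (List.ofFn x) u = algebraMap K (ExteriorAlgebra K V) (f x) := by
  have hinj : Function.Injective (contractPairing B p) := by
    rw [← LinearMap.ker_eq_bot, LinearMap.ker_eq_bot']
    intro u hu
    refine Subtype.ext (eq_zero_of_iterContract_eq_zero hnd le_rfl u.2 fun x => ?_)
    rw [← algebraMap_contractPairing_ιMulti, hu]
    simp
  obtain ⟨u, hu⟩ := (LinearMap.injective_iff_surjective_of_finrank_eq_finrank
    Subspace.dual_finrank_eq.symm).1 hinj (exteriorPower.alternatingMapLinearEquiv f)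
  refine ⟨u, fun x => ?_⟩
  rw [← algebraMap_contractPairing_ιMulti, hu,
    exteriorPower.alternatingMapLinearEquiv_apply_ιMulti]

end Duality

/-! ### Invariant structures and their partial maps -/

section InvariantForm

variable {K : Type*} [Field K] [CharZero K] {V : Type*} [AddCommGroup V] [Module K V]
  {B : LinearMap.BilinForm K V} {n : ℕ} {μ : V [⋀^Fin n]→ₗ[K] V}

/-- For `j = 0` this is invariance with `b = a₀`; skew-symmetry moves `a_j` to position `0`. -/
theorem IsInvariantForm.apply_apply_self {hn : 0 < n} (hμ : IsInvariantForm B hn μ)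
    (a : Fin n → V) (j : Fin n) : B (a j) (μ a) = 0 := by
  have h0 : ∀ a : Fin n → V, B (a ⟨0, hn⟩) (μ a) = 0 := fun a => by
    have := hμ (a ⟨0, hn⟩) a
    rwa [Function.update_eq_self, self_eq_neg] at this
  rcases eq_or_ne (⟨0, hn⟩ : Fin n) j with rfl | hj
  · exact h0 a
  · have := h0 (a ∘ Equiv.swap ⟨0, hn⟩ j)
    rw [μ.map_swap _ hj] at this
    simpa using this

/-- The alternating form `(a₀, …, a_n) ↦ (a₀, {a₁, …, a_n})` attached to an invariant
skew-symmetric `n`-ary structure. -/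
def IsInvariantForm.toAlternatingMap {hn : 0 < n} (hμ : IsInvariantForm B hn μ) :
    V [⋀^Fin (n + 1)]→ₗ[K] K where
  toMultilinearMap := LinearMap.uncurryLeft (M := fun _ => V)
    { toFun := fun b => (B b).compMultilinearMap μ.toMultilinearMap
      map_add' := fun b c => by ext; simp
      map_smul' := fun t b => by ext; simp }
  map_eq_zero_of_eq' := by
    intro v i j hij hne
    have key : ∀ k : Fin n, v 0 = v k.succ → B (v 0) (μ (Fin.tail v)) = 0 := fun k hk => by
      rw [hk]; exact hμ.apply_apply_self (Fin.tail v) k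
    change B (v 0) (μ (Fin.tail v)) = 0
    induction i using Fin.cases with
    | zero =>
      obtain ⟨k, rfl⟩ := Fin.exists_succ_eq.2 hne.symm
      exact key k hij
    | succ i =>
      induction j using Fin.cases with
      | zero => exact key i hij.symm
      | succ j =>
        rw [μ.map_eq_zero_of_eq (Fin.tail v) hij (fun h => hne (congrArg _ h)), map_zero]

theorem IsInvariantForm.exists_isDerivedFrom [FiniteDimensional K V] {hn : 0 < n}
    (hμ : IsInvariantForm B hn μ) (hB : B.IsSymm) (hnd : B.Nondegenerate) :
    ∃ m : ⋀[K]^(n + 1) V, IsDerivedFrom B μ m := by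
  obtain ⟨m, hm⟩ := exists_iterContract_eq hnd hμ.toAlternatingMap
  refine ⟨m, fun a => ?_⟩
  rw [iterPoissonBracket_eq B hB]
  obtain ⟨y, hy⟩ := exists_ι_of_mem (by simpa using iterContract_mem (B := B) m.2 (List.ofFn a))
  rw [← hy]
  congr 1
  refine (B.toDual hnd).injective (LinearMap.ext fun b => ?_)
  have h := hm (Fin.cons b a)
  rw [List.ofFn_cons, iterContract_cons, ← hy, ExteriorAlgebra.ι,
    CliffordAlgebra.contractLeft_ι] at h
  have h' : B b y = B b (μ a) := (algebraMap K (ExteriorAlgebra K V)).injective h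
  rw [LinearMap.BilinForm.toDual_def, LinearMap.BilinForm.toDual_def, hB.eq y b,
    hB.eq (μ a) b, h']

end InvariantForm

section Equivalence

theorem neg_one_pow_zsmul_eq_zero {A : Type*} [AddCommGroup A] {k : ℕ} {x : A} :
    (-1 : ℤ) ^ k • x = 0 ↔ x = 0 := by
  rcases Nat.even_or_odd k with h | h <;> simp [h.neg_one_pow]

variable {K : Type*} [Field K] {V : Type*} [AddCommGroup V] [Module K V] [FiniteDimensional K V]
  {B : LinearMap.BilinForm K V} {n : ℕ} {μ : V [⋀^Fin n]→ₗ[K] V}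

/-- The partial map `μ_{a₁, …, a_p}` is derived, up to sign, from `[a₁, [ … [a_p, m] … ]]`. -/
theorem IsDerivedFrom.ι_partialApply {m : ⋀[K]^(n + 1) V} (hm : IsDerivedFrom B μ m)
    (hB : B.IsSymm) {p : ℕ} (hp : p ≤ n) (a : Fin p → V) (c : Fin (n - p) → V) :
    ExteriorAlgebra.ι K (partialApply hp μ a c) = iterContract B (List.ofFn c)
      ((-1 : ℤ) ^ (p * (n - p)) • iterPoissonBracket B a (m : ExteriorAlgebra K V)) := by
  have h : List.ofFn (fun i => Fin.append a c (Fin.cast (by omega : n = p + (n - p)) i)) =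
      List.ofFn a ++ List.ofFn c := by
    rw [← List.ofFn_fin_append]
    exact (List.ofFn_congr (by omega) _).symm
  change ExteriorAlgebra.ι K (μ fun i => Fin.append a c (Fin.cast (by omega) i)) = _
  rw [hm, iterPoissonBracket_eq B hB, iterPoissonBracket_eq B hB, h, iterContract_append,
    iterContract_comm, map_zsmul, List.length_ofFn, List.length_ofFn]

theorem IsDerivedFrom.isNaryLieAlgebra_iff [CharZero K] {m : ⋀[K]^(n + 1) V}
    (hm : IsDerivedFrom B μ m) (hB : B.IsSymm) (hnd : B.Nondegenerate) {r l : ℕ} (hlr : l ≤ r)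
    (hrn : r < n) :
    IsNaryLieAlgebra μ r l hlr hrn ↔ ∀ (a : Fin r → V) (b : Fin l → V),
      poissonBracket B (iterPoissonBracket B a (m : ExteriorAlgebra K V))
        (iterPoissonBracket B b (m : ExteriorAlgebra K V)) = 0 := by
  refine forall_congr' fun a => forall_congr' fun b => ?_
  have hmem : ∀ {p : ℕ} (hp : p < n) (c : Fin p → V),
      iterPoissonBracket B c (m : ExteriorAlgebra K V) ∈ ⋀[K]^(n - p + 1) V := fun hp c => by
    rw [iterPoissonBracket_eq B hB]
    convert iterContract_mem (B := B) m.2 (List.ofFn c) using 2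
    simp; omega
  have hln := hlr.trans_lt hrn
  set v := iterPoissonBracket B a (m : ExteriorAlgebra K V) with hv
  set w := iterPoissonBracket B b (m : ExteriorAlgebra K V) with hw
  have key := fun x => iterContract_poissonBracket hB (Nat.sub_pos_of_lt hrn)
    (Nat.sub_pos_of_lt hln) rfl (zsmul_mem (hmem hrn a) _) (zsmul_mem (hmem hln b) _)
    (hm.ι_partialApply hB hrn.le a) (hm.ι_partialApply hB hln.le b) x
  simp only [← hv, ← hw, map_zsmul, LinearMap.smul_apply] at key
  constructor
  · intro h
    have hdeg : poissonBracket B v w ∈ ⋀[K]^(n - r + (n - l)) V := by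
      rw [poissonBracket_apply]
      refine Submodule.sum_mem _ fun i _ => ?_
      rw [ExteriorAlgebra.exteriorPower, pow_add]
      exact Submodule.mul_mem_mul (contractRight_mem (hmem hrn a) _)
        (contractLeft_mem _ (hmem hln b))
    refine eq_zero_of_iterContract_eq_zero hnd (q := n - r + (n - l) - 1) (Nat.sub_le _ _) hdeg
      fun x => ?_
    have hx := key x
    rw [h] at hx
    simpa [neg_one_pow_zsmul_eq_zero] using hx
  · intro h
    funext x
    have hx := key x
    rw [h] at hx
    refine ExteriorAlgebra.ι_leftInverse (R := K).injective ?_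
    simp only [map_zero, smul_zero] at hx
    rw [Pi.zero_apply, map_zero]
    exact neg_one_pow_zsmul_eq_zero.1 (neg_eq_zero.1 hx.symm)

end Equivalence

theorem mainTheorem2 {𝕜 : Type*} [RCLike 𝕜] {V : Type*} [AddCommGroup V] [Module 𝕜 V]
    [FiniteDimensional 𝕜 V] (B : LinearMap.BilinForm 𝕜 V) (hB : B.IsSymm) (hnd : B.Nondegenerate)
    (n r l : ℕ) (hlr : l ≤ r) (hrn : r < n) (μ : V [⋀^Fin n]→ₗ[𝕜] V)
    (hμ : IsInvariantForm B (Nat.zero_lt_of_lt hrn) μ) :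
    (∃ m : ⋀[𝕜]^(n + 1) V, IsDerivedFrom B μ m) ∧
    ∀ m : ⋀[𝕜]^(n + 1) V, IsDerivedFrom B μ m →
      (IsNaryLieAlgebra μ r l hlr hrn ↔
        ∀ (a : Fin r → V) (b : Fin l → V),
          poissonBracket B (iterPoissonBracket B a (m : ExteriorAlgebra 𝕜 V))
            (iterPoissonBracket B b (m : ExteriorAlgebra 𝕜 V)) = 0) := by
  exact ⟨hμ.exists_isDerivedFrom hB hnd, fun m hm => hm.isNaryLieAlgebra_iff hB hnd hlr hrn⟩
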